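/- Let $\Gamma\subset PSL(2,\mathbb R)$ be a group acting freely and properly discontinuously on the upper half-plane $\mathbb H$ (equivalently, a discrete torsion-free group), and let $R=\mathbb H/\Gamma$ be the associated hyperbolic surface. Let $\delta$ be the hyperbolic distance (curvature $-1$) on $\mathbb H$, and for $z,z_0\in\mathbb H$ let $\delta_R(z,z_0)=\inf_{A\in\Gamma}\delta(z,Az_0)$ be the distance on $R$ of the points they represent. Let $\operatorname{inj}(z)\in(0,\infty]$ be the injectivity radius of $R$ at the point represented by $z$: the supremum of the $r$ such that $\mathbb H\to R$ is injective on the open ball of radius $r$ about $z$ (with $\infty^{-1}=0$). Let $D=y^2(\partial_x^2+\partial_y^2)$ be the hyperbolic Laplacian. The integral kernel of $(D-2)^{-1}$ on $\mathbb H$ is $$Q_2(z,w)=-\frac1{2\pi}\Bigl(\frac u2\log\frac{u+1}{u-1}-1\Bigr),\qquad u=\cosh\delta(z,w),\quad z\ne w,$$ and the Green's function (the kernel of $(D-2)^{-1}$) of $R$ is $G_2(z,z_0)=\sum_{A\in\Gamma}Q_2(z,Az_0)$. Then: 1. If $z\notin\Gamma z_0$, the series for $G_2(z,z_0)$ converges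 absolutely and $-Q_2(z,z_0)\le -G_2(z,z_0)$. 2. For every $a$ there is a constant $c=c(a)>0$ such that, whenever $R$ has area at most $a$ (so that, for surfaces of finite type, $c$ depends only on the genus and the number of punctures), for all $z,z_0$ with $\delta_R(z,z_0)\ge 1$, $$-G_2(z,z_0)\le c\,\min_{\zeta=z,z_0}\operatorname{inj}(\zeta)^{-1}\,e^{-\delta_R(z,z_0)}.$$ 3. There is an absolute constant $c>0$ such that for every such $\Gamma$ (of finite or infinite covolume) and all $z,z_0$ with $\delta_R(z,z_0)\ge1$, $$-G_2(z,z_0)\le c\,\max\bigl(1,\min_{\zeta=z,z_0}\operatorname{inj}(\zeta)^{-1}\bigr)\,e^{-\delta_R(z,z_0)}.$$ -/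

import Mathlib

open MeasureTheory
open scoped UpperHalfPlane MatrixGroups ENNReal NNReal

noncomputable section

namespace WPGreen

/-- The centre `{1, -1}` of `SL(2, ℝ)` acts trivially on the upper half-plane. -/
theorem center_smul {g : SL(2, ℝ)} (hg : g ∈ Subgroup.center SL(2, ℝ)) (z : ℍ) : g • z = z := by
  obtain ⟨r, hr, hrg⟩ := Matrix.SpecialLinearGroup.mem_center_iff.mp hg
  have hr0 : r ≠ 0 := by
    rintro rfl
    simp at hr
  have h00 : g 0 0 = r := by rw [← hrg]; simp
  have h01 : g 0 1 = 0 := by rw [← hrg]; simp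
  have h10 : g 1 0 = 0 := by rw [← hrg]; simp
  have h11 : g 1 1 = r := by rw [← hrg]; simp
  apply UpperHalfPlane.ext
  rw [UpperHalfPlane.coe_specialLinearGroup_apply]
  simp [h00, h01, h10, h11]
  exact mul_div_cancel_left₀ _ (by exact_mod_cast hr0)

/-- The homomorphism from `PSL(2, ℝ)` to permutations of `ℍ` induced by the Möbius action. -/
def permHom : PSL(2, ℝ) →* Equiv.Perm ℍ :=
  QuotientGroup.lift (Subgroup.center SL(2, ℝ)) (MulAction.toPermHom SL(2, ℝ) ℍ)
    (fun _ hg => Equiv.ext (fun z => center_smul hg z))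

/-- The Möbius action of `PSL(2, ℝ)` on the upper half-plane. -/
instance : MulAction PSL(2, ℝ) ℍ := MulAction.compHom ℍ permHom

theorem mk_smul (g : SL(2, ℝ)) (z : ℍ) : (QuotientGroup.mk g : PSL(2, ℝ)) • z = g • z := rfl

/-- `Γ` uniformizes a hyperbolic surface `R = ℍ / Γ`: it is the deck group of the covering
`ℍ → ℍ / Γ`, i.e. it acts freely and properly discontinuously (equivalently, `Γ` is a
discrete torsion-free subgroup of `PSL(2, ℝ)`). -/
structure IsUniformizing (Γ : Subgroup PSL(2, ℝ)) : Prop where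
  free : ∀ (A : Γ) (z : ℍ), A • z = z → A = 1
  properlyDiscontinuous : ProperlyDiscontinuousSMul Γ ℍ

/-- The hyperbolic area of `R = ℍ / Γ` is at most `a`. -/
def AreaLE (Γ : Subgroup PSL(2, ℝ)) (a : ℝ) : Prop :=
  ∃ F : Set ℍ, IsFundamentalDomain Γ F (volume : Measure ℍ) ∧ volume F ≤ ENNReal.ofReal a

/-- The distance on `R = ℍ / Γ` between the points represented by `z` and `z₀`. -/
def quotDist (Γ : Subgroup PSL(2, ℝ)) (z z₀ : ℍ) : ℝ :=
  ⨅ A : Γ, dist z (A • z₀)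

/-- The injectivity radius of `R = ℍ / Γ` at the point represented by `z`: the supremum of the
radii `r` for which the covering map `ℍ → ℍ / Γ` is injective on the open ball `B(z, r)`.
It is `∞` exactly when `Γ` is trivial. -/
def injRad (Γ : Subgroup PSL(2, ℝ)) (z : ℍ) : ℝ≥0∞ :=
  ⨆ (r : ℝ≥0) (_ : Set.InjOn
      (fun w : ℍ => (Quotient.mk (MulAction.orbitRel Γ ℍ) w : MulAction.orbitRel.Quotient Γ ℍ))
      (Metric.ball z (r : ℝ))), (r : ℝ≥0∞)

/-- The reciprocal of the injectivity radius (`injRad` is positive for a uniformizing group, and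
the reciprocal is `0` when the injectivity radius is infinite). -/
def invInj (Γ : Subgroup PSL(2, ℝ)) (z : ℍ) : ℝ :=
  ((injRad Γ z)⁻¹).toReal

/-- The Legendre function of the second kind of degree one,
`u ↦ (u / 2) log ((u + 1) / (u - 1)) - 1`, for `u > 1`. -/
def legendreQ (u : ℝ) : ℝ :=
  u / 2 * Real.log ((u + 1) / (u - 1)) - 1

/-- The integral kernel of `(D - 2)⁻¹` on `ℍ`, where `D = y² (∂²/∂x² + ∂²/∂y²)`. With
`2 = s (s - 1)` for `s = 2`, it is `-(1 / 2π)` times the Legendre function of degree `s - 1 = 1`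
at `cosh δ(z, w)`; it is negative, has the logarithmic pole `(1 / 2π) log δ` and decays
as `exp (-2 δ)`. It is used only for `z ≠ w`. -/
def Q₂ (z w : ℍ) : ℝ :=
  -(1 / (2 * Real.pi)) * legendreQ (Real.cosh (dist z w))

/-- The Green's function of `R = ℍ / Γ`, i.e. the integral kernel of `(D - 2)⁻¹` on `R`: the sum
over `Γ` of the kernel on `ℍ`. -/
def G₂ (Γ : Subgroup PSL(2, ℝ)) (z z₀ : ℍ) : ℝ :=
  ∑' A : Γ, Q₂ z (A • z₀)

end WPGreen

end

/-!
The kernel satisfies `0 ≤ -Q₂ z w ≤ 16 exp (-2 δ(z, w))` for `δ(z, w) ≥ 1`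
(`neg_Q₂_nonneg`, `neg_Q₂_le`), so the convergence and the upper bounds reduce
to counting orbit points, and the lower bound is the comparison of a sum of nonnegative terms with
the term of the identity.
Suppose that every nontrivial element of `Γ` moves `z₀` by at least `s ≤ 1`.

* At most `O(1 / s)` elements move `z₀` by at most two (`exists_card_le_div`). After conjugation
  `z₀ = i`, and by pigeonhole on the matrix entries it suffices to count lifts to `SL(2, ℝ)` that
  are close to the identity. As taking commutators contracts there, all of them commute with a
  nontrivial element `A` of nearly minimal size (`norm_commutator_sub_one_le`). The matrices of
  determinant one close to the identity that commute with `A` form a curve, on which a single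
  coordinate is bi-Lipschitz (`exists_coordinate`, `norm_sub_le_of_traceless`), and the elements
  of the group are separated on it by a multiple of `s` (`card_near_one_le`). This plays the role
  of the collar lemma, and gives `1 / s` where a comparison of areas alone would give `1 / s ^ 2`.
* Hence the unit discs about the orbit points overlap `O(1 / s)` times. Comparing areas, a disc of
  radius `t` contains `O(exp t / s)` orbit points (`exists_card_orbit_le`), and summing over shells
  bounds the orbital sum of `exp (-2 δ)` by `O(exp (-δ_R) / s)` (`exists_sum_exp_le`).

One may take `s = 1 / max 1 (inj z₀)⁻¹` (`IsUniformizing.inv_max_le_dist`), and the symmetry of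
`G₂` in its arguments gives the minimum over both points (`exists_neg_G₂_le`). If the area is at
most `a`, then an embedded disc has area at most `a`, so the injectivity radius is bounded above
(`exists_le_invInj`) and the maximum with `1` can be absorbed into the constant.
-/

namespace WPGreen

/-! ### The action of `PSL(2, ℝ)` -/

theorem dist_psl_smul (g : PSL(2, ℝ)) (z w : ℍ) : dist (g • z) (g • w) = dist z w := by
  induction g using QuotientGroup.induction_on with
  | H g => rw [mk_smul, mk_smul, dist_smul]

instance : IsIsometricSMul PSL(2, ℝ) ℍ :=
  ⟨fun g => Isometry.of_dist_eq fun z w => dist_psl_smul g z w⟩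

instance : SMulInvariantMeasure PSL(2, ℝ) ℍ (volume : Measure ℍ) := by
  refine ⟨fun g s hs => ?_⟩
  induction g using QuotientGroup.induction_on with
  | H g =>
    exact measure_preimage_smul (μ := (volume : Measure ℍ)) (Matrix.SpecialLinearGroup.mapGL ℝ g) s

instance (Γ : Subgroup PSL(2, ℝ)) : IsIsometricSMul Γ ℍ :=
  ⟨fun g => Isometry.of_dist_eq fun z w => dist_psl_smul g z w⟩

instance (Γ : Subgroup PSL(2, ℝ)) : SMulInvariantMeasure Γ ℍ (volume : Measure ℍ) :=
  ⟨fun g _ hs => SMulInvariantMeasure.measure_preimage_smul (g : PSL(2, ℝ)) hs⟩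

theorem dist_smul_comm (Γ : Subgroup PSL(2, ℝ)) (A : Γ) (z w : ℍ) :
    dist z (A • w) = dist w (A⁻¹ • z) := by
  rw [← dist_smul A w (A⁻¹ • z), smul_inv_smul, dist_comm]

theorem quotDist_comm (Γ : Subgroup PSL(2, ℝ)) (z w : ℍ) : quotDist Γ z w = quotDist Γ w z :=
  (Equiv.inv Γ).iInf_congr fun A => (dist_smul_comm Γ A z w).symm

theorem G₂_comm (Γ : Subgroup PSL(2, ℝ)) (z w : ℍ) : G₂ Γ z w = G₂ Γ w z :=
  by
  unfold G₂
  rw [← (Equiv.inv Γ).tsum_eq]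
  refine tsum_congr fun A => ?_
  simp only [Q₂, Equiv.inv_apply, dist_smul_comm Γ A⁻¹ z w, inv_inv]

theorem quotDist_le (Γ : Subgroup PSL(2, ℝ)) (z w : ℍ) (A : Γ) :
    quotDist Γ z w ≤ dist z (A • w) :=
  ciInf_le ⟨0, by rintro _ ⟨B, rfl⟩; exact dist_nonneg⟩ A

/-! ### The injectivity radius -/

theorem injRad_le_dist (Γ : Subgroup PSL(2, ℝ)) (hΓ : IsUniformizing Γ) (z : ℍ) (A : Γ)
    (hA : A ≠ 1) : injRad Γ z ≤ ENNReal.ofReal (dist z (A • z)) := by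
  refine iSup₂_le fun r hr => ?_
  by_contra! h
  rw [← ENNReal.ofReal_coe_nnreal, ENNReal.ofReal_lt_ofReal_iff_of_nonneg dist_nonneg] at h
  have h0 : (0 : ℝ) < r := dist_nonneg.trans_lt h
  refine hA (hΓ.free A z (hr (by simpa [dist_comm] using h) (by simpa using h0) ?_))
  exact Quotient.sound ⟨A, rfl⟩

theorem IsUniformizing.finite_dist_le {Γ : Subgroup PSL(2, ℝ)} (hΓ : IsUniformizing Γ)
    (z z₀ : ℍ) (t : ℝ) : {A : Γ | dist z (A • z₀) ≤ t}.Finite := by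
  have := hΓ.properlyDiscontinuous
  refine (ProperlyDiscontinuousSMul.finite_disjoint_inter_image (Γ := Γ)
    (isCompact_singleton (x := z₀)) (isCompact_closedBall z t)).subset fun A hA => ?_
  have hmem : A • z₀ ∈ ((A • ·) '' {z₀}) ∩ Metric.closedBall z t :=
    ⟨⟨z₀, rfl, rfl⟩, by rw [Metric.mem_closedBall, dist_comm]; exact hA⟩
  exact ⟨_, hmem⟩

theorem IsUniformizing.countable {Γ : Subgroup PSL(2, ℝ)} (hΓ : IsUniformizing Γ) :
    Countable Γ := by
  rw [← Set.countable_univ_iff]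
  have h : (Set.univ : Set Γ) =
      ⋃ n : ℕ, {A : Γ | dist UpperHalfPlane.I (A • UpperHalfPlane.I) ≤ n} := by
    ext A
    simpa using exists_nat_ge _
  rw [h]
  exact Set.countable_iUnion fun n => (hΓ.finite_dist_le _ _ _).countable

/-- A uniformizing group moves each point by a definite amount. -/
theorem IsUniformizing.exists_le_dist {Γ : Subgroup PSL(2, ℝ)} (hΓ : IsUniformizing Γ) (z : ℍ) :
    ∃ s : ℝ, 0 < s ∧ ∀ A : Γ, A ≠ 1 → s ≤ dist z (A • z) := by
  by_cases hne : ∃ A : Γ, A ≠ 1 ∧ dist z (A • z) ≤ 1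
  · have hfin : {A : Γ | A ≠ 1 ∧ dist z (A • z) ≤ 1}.Finite :=
      (hΓ.finite_dist_le z z 1).subset fun _ hA => hA.2
    obtain ⟨A, hA, hmin⟩ := Set.exists_min_image _ (fun A : Γ => dist z (A • z)) hfin hne
    refine ⟨dist z (A • z), dist_pos.mpr fun h => hA.1 (hΓ.free A z h.symm), fun B hB => ?_⟩
    by_cases hB1 : dist z (B • z) ≤ 1
    · exact hmin B ⟨hB, hB1⟩
    · exact hA.2.trans (not_le.mp hB1).le
  · push Not at hne
    exact ⟨1, one_pos, fun A hA => (hne A hA).le⟩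

theorem injOn_ball_of_le_dist {Γ : Subgroup PSL(2, ℝ)} {z : ℍ} {s : ℝ}
    (h : ∀ A : Γ, A ≠ 1 → s ≤ dist z (A • z)) :
    Set.InjOn (fun w : ℍ => (Quotient.mk (MulAction.orbitRel Γ ℍ) w :
      MulAction.orbitRel.Quotient Γ ℍ)) (Metric.ball z (s / 2)) := by
  intro w hw w' hw' hww
  obtain ⟨A, rfl⟩ : ∃ A : Γ, A • w' = w := Quotient.exact hww
  by_cases hA : A = 1
  · simp [hA]
  have h1 := h A hA
  have h2 := dist_triangle z (A • w') (A • z)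
  rw [dist_smul] at h2
  rw [Metric.mem_ball] at hw hw'
  rw [dist_comm] at hw
  linarith

theorem IsUniformizing.injRad_ne_zero {Γ : Subgroup PSL(2, ℝ)} (hΓ : IsUniformizing Γ) (z : ℍ) :
    injRad Γ z ≠ 0 := by
  obtain ⟨s, hs, h⟩ := hΓ.exists_le_dist z
  have h1 : ((s / 2).toNNReal : ℝ≥0∞) ≤ injRad Γ z := by
    refine le_iSup₂_of_le (s / 2).toNNReal ?_ le_rfl
    rw [Real.coe_toNNReal _ (by positivity)]
    exact injOn_ball_of_le_dist h
  refine (lt_of_lt_of_le ?_ h1).ne'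
  simpa using hs

/-- The displacement of `z` is at least `min 1 inj`, written as a reciprocal so that an infinite
injectivity radius (where `invInj` is `0`) needs no separate treatment. -/
theorem IsUniformizing.inv_max_le_dist {Γ : Subgroup PSL(2, ℝ)} (hΓ : IsUniformizing Γ) (z : ℍ)
    (A : Γ) (hA : A ≠ 1) : (max 1 (invInj Γ z))⁻¹ ≤ dist z (A • z) := by
  have h0 : 0 < dist z (A • z) := dist_pos.mpr fun h => hA (hΓ.free A z h.symm)
  have h1 := ENNReal.inv_le_inv.mpr (injRad_le_dist Γ hΓ z A hA)
  have h2 := ENNReal.toReal_mono (ENNReal.inv_ne_top.mpr (hΓ.injRad_ne_zero z)) h1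
  rw [ENNReal.toReal_inv, ENNReal.toReal_ofReal h0.le] at h2
  rw [inv_le_comm₀ (by positivity) h0]
  exact h2.trans (le_max_right _ _)

/-! ### The Legendre function -/

theorem legendreQ_nonneg {u : ℝ} (hu : 1 < u) : 0 ≤ legendreQ u := by
  have hx : |1 / u| < 1 := by
    rw [abs_of_pos (by positivity), div_lt_one (by positivity)]
    exact hu
  have hs := Real.hasSum_log_sub_log_of_abs_lt_one hx
  have h0 := le_hasSum hs 0 fun k _ => by positivity
  have hx' : 1 / u < 1 := (le_abs_self _).trans_lt hx
  rw [← Real.log_div (by positivity) (by linarith)] at h0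
  have h2 : (1 + 1 / u) / (1 - 1 / u) = (u + 1) / (u - 1) := by
    have : u - 1 ≠ 0 := by linarith
    field_simp
  rw [h2] at h0
  have h3 : u / 2 * (2 * (1 / u)) = 1 := by field_simp
  have h4 : u / 2 * (2 * (1 / u)) ≤ u / 2 * Real.log ((u + 1) / (u - 1)) := by
    gcongr
    simpa using h0
  unfold legendreQ
  linarith

theorem legendreQ_le {u : ℝ} (hu : 1 < u) : legendreQ u ≤ 1 / (u ^ 2 - 1) := by
  have h1 : 0 < u - 1 := by linarith
  have hy : 0 < (u + 1) / (u - 1) := by positivity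
  have hlog : 0 ≤ Real.log ((u + 1) / (u - 1)) :=
    Real.log_nonneg ((one_le_div h1).mpr (by linarith))
  -- `t ≤ sinh t` at `t = log ((u + 1) / (u - 1))`
  have h2 := Real.self_le_sinh_iff.mpr hlog
  rw [Real.sinh_log hy] at h2
  have h3 : u / 2 * ((((u + 1) / (u - 1)) - ((u + 1) / (u - 1))⁻¹) / 2) - 1 = 1 / (u ^ 2 - 1) := by
    have : u ^ 2 - 1 ≠ 0 := by nlinarith
    have : u + 1 ≠ 0 := by linarith
    field_simp
    ring
  rw [← h3]
  unfold legendreQ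
  gcongr

theorem legendreQ_cosh_le {d : ℝ} (hd : 1 ≤ d) :
    legendreQ (Real.cosh d) ≤ 16 * Real.exp (-(2 * d)) := by
  have h1 : 1 < Real.cosh d := Real.one_lt_cosh.mpr (by linarith)
  refine (legendreQ_le h1).trans ?_
  have h2 : Real.cosh d ^ 2 - 1 = Real.sinh d ^ 2 := by rw [Real.cosh_sq]; ring
  have h3 : Real.exp d / 4 ≤ Real.sinh d := by
    rw [Real.sinh_eq]
    have := Real.add_one_le_exp d
    have h4 : Real.exp (-d) ≤ 1 := Real.exp_le_one_iff.mpr (by linarith)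
    linarith
  have h5 : 16 * Real.exp (-(2 * d)) = 1 / (Real.exp d / 4) ^ 2 := by
    rw [Real.exp_neg, two_mul, Real.exp_add]
    field_simp
    norm_num
  rw [h2, h5]
  gcongr

theorem neg_Q₂ (z w : ℍ) :
    -Q₂ z w = 1 / (2 * Real.pi) * legendreQ (Real.cosh (dist z w)) := by
  unfold Q₂
  ring

theorem neg_Q₂_nonneg {z w : ℍ} (h : z ≠ w) : 0 ≤ -Q₂ z w := by
  rw [neg_Q₂]
  have := legendreQ_nonneg (Real.one_lt_cosh.mpr (dist_pos.mpr h).ne')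
  positivity

theorem neg_Q₂_le {z w : ℍ} (h : 1 ≤ dist z w) : -Q₂ z w ≤ 16 * Real.exp (-(2 * dist z w)) := by
  rw [neg_Q₂]
  have h1 : 1 / (2 * Real.pi) ≤ 1 := by
    rw [div_le_one (by positivity)]
    linarith [Real.two_le_pi]
  calc _ ≤ 1 / (2 * Real.pi) * (16 * Real.exp (-(2 * dist z w))) := by
        gcongr
        exact legendreQ_cosh_le h
    _ ≤ 1 * (16 * Real.exp (-(2 * dist z w))) := by gcongr
    _ = _ := one_mul _

/-! ### Volumes of hyperbolic balls -/

theorem volume_ball_eq (z w : ℍ) (t : ℝ) :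
    (volume : Measure ℍ) (Metric.ball z t) = volume (Metric.ball w t) := by
  obtain ⟨g, rfl⟩ := MulAction.exists_smul_eq SL(2, ℝ) w z
  rw [← mk_smul, ← Metric.smul_ball, measure_smul]

theorem volume_ball_pos (z : ℍ) {t : ℝ} (ht : 0 < t) :
    0 < (volume : Measure ℍ) (Metric.ball z t) := by
  rw [UpperHalfPlane.volume_eq_lintegral, setLIntegral_pos_iff (by fun_prop)]
  have hsub : UpperHalfPlane.coe '' Metric.ball z t ⊆
      Function.support fun z : ℂ => (((1 / ‖z.im‖₊) ^ 2 : NNReal) : ℝ≥0∞) := by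
    rintro _ ⟨w, -, rfl⟩
    simp [w.im_ne_zero]
  rw [Set.inter_eq_self_of_subset_right hsub]
  exact (UpperHalfPlane.isOpenEmbedding_coe.isOpenMap _ Metric.isOpen_ball).measure_pos _
    ⟨z, z, Metric.mem_ball_self ht, rfl⟩

theorem re_sq_add_one_lt {w : ℍ} {t : ℝ} (ht : 0 ≤ t) (hw : dist w UpperHalfPlane.I < t) :
    w.re ^ 2 + w.im ^ 2 + 1 < 2 * Real.cosh t * w.im := by
  have h1 : Real.cosh (dist w UpperHalfPlane.I) < Real.cosh t := by
    rwa [Real.cosh_lt_cosh, abs_of_nonneg dist_nonneg, abs_of_nonneg ht]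
  have := w.im_pos
  rw [UpperHalfPlane.cosh_dist', div_lt_iff₀ (by simpa using this)] at h1
  simp at h1
  linarith

/-- The area of a hyperbolic disc grows at most exponentially in its radius. -/
theorem volume_ball_le (z : ℍ) {t : ℝ} (ht : 0 ≤ t) :
    (volume : Measure ℍ) (Metric.ball z t) ≤ ENNReal.ofReal (8 * Real.cosh t) := by
  rw [volume_ball_eq z UpperHalfPlane.I, UpperHalfPlane.volume_eq_lintegral]
  set K : ℝ := 2 * Real.cosh t with hK
  have hK0 : 0 < K := by positivity
  -- the disc about `i` lies in the region `1 / K < y`, `x ^ 2 ≤ K * y`, of hyperbolic area `4 * K`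
  let S : Set (ℝ × ℝ) := {p | 1 / K < p.2 ∧ p.1 ^ 2 ≤ K * p.2}
  have hS : MeasurableSet S :=
    (measurableSet_lt measurable_const measurable_snd).inter
      (measurableSet_le (measurable_fst.pow_const 2) (measurable_snd.const_mul K))
  let f : ℝ × ℝ → ℝ≥0∞ := S.indicator fun p => ENNReal.ofReal (1 / p.2 ^ 2)
  have hf : Measurable f := Measurable.indicator (by fun_prop) hS
  have hinner : ∀ y : ℝ, ∫⁻ x : ℝ, f (x, y) ≤
      (Set.Ioi (1 / K)).indicator
        (fun y => ENNReal.ofReal (2 * √K * y ^ (-(3 / 2) : ℝ))) y := by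
    intro y
    by_cases hy : y ∈ Set.Ioi (1 / K)
    · have hy0 : 0 < y := lt_trans (by positivity) (Set.mem_Ioi.mp hy)
      rw [Set.indicator_of_mem hy]
      calc ∫⁻ x : ℝ, f (x, y)
          ≤ ∫⁻ x : ℝ, (Set.Icc (-√(K * y)) (√(K * y))).indicator
              (fun _ => ENNReal.ofReal (1 / y ^ 2)) x := by
            refine lintegral_mono fun x => ?_
            by_cases hx : (x, y) ∈ S
            · have hx' : x ∈ Set.Icc (-√(K * y)) (√(K * y)) := abs_le.mp (Real.abs_le_sqrt hx.2)
              rw [Set.indicator_of_mem hx', show f (x, y) = _ from Set.indicator_of_mem hx _]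
            · rw [show f (x, y) = _ from Set.indicator_of_notMem hx _]
              exact zero_le
        _ = ENNReal.ofReal (1 / y ^ 2) * ENNReal.ofReal (√(K * y) - -√(K * y)) := by
            rw [lintegral_indicator_const measurableSet_Icc, Real.volume_Icc]
        _ = ENNReal.ofReal (2 * √K * y ^ (-(3 / 2) : ℝ)) := by
            rw [← ENNReal.ofReal_mul (by positivity), Real.sqrt_mul hK0.le]
            congr 1
            have : y ^ (-(3 / 2) : ℝ) = √y / y ^ 2 := by
              rw [Real.sqrt_eq_rpow, ← Real.rpow_natCast, ← Real.rpow_sub hy0]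
              norm_num
            rw [this]
            ring
    · rw [Set.indicator_of_notMem hy]
      refine (lintegral_eq_zero_of_ae_eq_zero (Filter.Eventually.of_forall fun x => ?_)).le
      exact Set.indicator_of_notMem (fun h => hy h.1) _
  calc ∫⁻ z : ℂ in (↑) '' Metric.ball UpperHalfPlane.I t, ↑((1 / ‖z.im‖₊) ^ 2 : NNReal)
      ≤ ∫⁻ z : ℂ, f (Complex.measurableEquivRealProd z) := by
        rw [← lintegral_indicator
          (UpperHalfPlane.measurableEmbedding_coe.measurableSet_image.mpr measurableSet_ball)]
        refine lintegral_mono fun z => ?_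
        by_cases hz : z ∈ (UpperHalfPlane.coe '' Metric.ball UpperHalfPlane.I t)
        · rw [Set.indicator_of_mem hz]
          obtain ⟨w, hw, rfl⟩ := hz
          have h1 := re_sq_add_one_lt ht hw
          have h2 := w.im_pos
          have hmem : Complex.measurableEquivRealProd (w : ℂ) ∈ S := by
            refine ⟨?_, ?_⟩
            · simp only [Complex.measurableEquivRealProd_apply]
              rw [div_lt_iff₀ hK0]
              change 1 < w.im * K
              nlinarith [sq_nonneg w.re, sq_nonneg w.im]
            · simp only [Complex.measurableEquivRealProd_apply]
              change w.re ^ 2 ≤ K * w.im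
              nlinarith [sq_nonneg w.re, sq_nonneg w.im]
          rw [show f _ = _ from Set.indicator_of_mem hmem _]
          simp only [Complex.measurableEquivRealProd_apply]
          rw [← ENNReal.ofReal_coe_nnreal]
          apply le_of_eq
          congr 1
          simp
        · rw [Set.indicator_of_notMem hz]
          exact zero_le
    _ = ∫⁻ p : ℝ × ℝ, f p :=
        Complex.volume_preserving_equiv_real_prod.lintegral_comp hf
    _ = ∫⁻ y : ℝ, ∫⁻ x : ℝ, f (x, y) := by
        rw [Measure.volume_eq_prod, lintegral_prod_symm _ hf.aemeasurable]
    _ ≤ ∫⁻ y : ℝ, (Set.Ioi (1 / K)).indicator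
        (fun y => ENNReal.ofReal (2 * √K * y ^ (-(3 / 2) : ℝ))) y := lintegral_mono hinner
    _ = ENNReal.ofReal (∫ y in Set.Ioi (1 / K), 2 * √K * y ^ (-(3 / 2) : ℝ)) := by
        rw [lintegral_indicator measurableSet_Ioi, ofReal_integral_eq_lintegral_ofReal]
        · exact (integrableOn_Ioi_rpow_of_lt (by norm_num) (by positivity)).const_mul _
        · refine (ae_restrict_mem measurableSet_Ioi).mono fun y hy => ?_
          have : 0 < y := lt_trans (by positivity) (Set.mem_Ioi.mp hy)
          positivity
    _ = ENNReal.ofReal (8 * Real.cosh t) := by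
        rw [integral_const_mul, integral_Ioi_rpow_of_lt (by norm_num) (by positivity)]
        congr 1
        have : (1 / K) ^ (-(3 / 2) + 1 : ℝ) = √K := by
          rw [one_div, Real.inv_rpow hK0.le, ← Real.rpow_neg hK0.le, Real.sqrt_eq_rpow]
          norm_num
        rw [this]
        have h4 := Real.mul_self_sqrt hK0.le
        linear_combination 4 * h4

theorem volume_ball_ne_top (z : ℍ) (t : ℝ) : (volume : Measure ℍ) (Metric.ball z t) ≠ ⊤ :=
  measure_ball_lt_top.ne

/-- Hyperbolic discs have arbitrarily large area. -/
theorem exists_lt_volume_ball (a : ℝ≥0∞) (ha : a ≠ ⊤) :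
    ∃ r : ℝ, 0 < r ∧ ∀ z : ℍ, a < (volume : Measure ℍ) (Metric.ball z r) := by
  set γ : ℝ → ℍ := fun y => UpperHalfPlane.mk ⟨0, Real.exp y⟩ (Real.exp_pos y) with hγ
  have hiso : Isometry γ := UpperHalfPlane.isometry_vertical_line 0
  obtain ⟨N, hN⟩ := ENNReal.exists_nat_mul_gt (volume_ball_pos (γ 0) one_pos).ne' ha
  refine ⟨2 * N + 1, by positivity, fun z => hN.trans_le ?_⟩
  -- unit discs about points at mutual distance at least two on a geodesic are disjoint
  have hdisj : Set.PairwiseDisjoint (Finset.range N : Set ℕ)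
      (fun k : ℕ => Metric.ball (γ (2 * k)) 1) := by
    intro j _ k _ hjk
    refine Metric.ball_disjoint_ball ?_
    rw [hiso.dist_eq, Real.dist_eq, ← mul_sub, abs_mul]
    have h1 : (1 : ℤ) ≤ |(j : ℤ) - k| := Int.one_le_abs (by omega)
    have h2 : (1 : ℝ) ≤ |(j : ℝ) - k| := by exact_mod_cast h1
    norm_num
    linarith
  calc (N : ℝ≥0∞) * volume (Metric.ball (γ 0) 1)
      = ∑ k ∈ Finset.range N, volume (Metric.ball (γ (2 * k)) 1) := by
        rw [Finset.sum_congr rfl fun (k : ℕ) _ => volume_ball_eq (γ (2 * k)) (γ 0) 1]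
        simp
    _ = volume (⋃ k ∈ Finset.range N, Metric.ball (γ (2 * k)) 1) :=
        (measure_biUnion_finset hdisj fun _ _ => measurableSet_ball).symm
    _ ≤ volume (Metric.ball (γ 0) (2 * N + 1)) := by
        refine measure_mono (Set.iUnion₂_subset fun k hk => Metric.ball_subset_ball' ?_)
        have : (k : ℝ) ≤ N := by exact_mod_cast (Finset.mem_range.mp hk).le
        rw [hiso.dist_eq, Real.dist_eq, sub_zero, abs_of_nonneg (by positivity)]
        linarith
    _ = volume (Metric.ball z (2 * N + 1)) := volume_ball_eq _ _ _

/-! ### Displacement and matrix norm -/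

section Matrices

open scoped Matrix.Norms.Operator

theorem abs_apply_le_norm (M : Matrix (Fin 2) (Fin 2) ℝ) (i j : Fin 2) : |M i j| ≤ ‖M‖ := by
  rw [Matrix.linfty_opNorm_def]
  have h1 : ‖M i j‖₊ ≤ ∑ j, ‖M i j‖₊ :=
    Finset.single_le_sum (f := fun j => ‖M i j‖₊) (fun _ _ => zero_le) (Finset.mem_univ j)
  have h2 : ∑ j, ‖M i j‖₊ ≤ Finset.univ.sup fun i => ∑ j, ‖M i j‖₊ :=
    Finset.le_sup (f := fun i => ∑ j, ‖M i j‖₊) (Finset.mem_univ i)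
  exact_mod_cast h1.trans h2

theorem norm_le_two_mul {M : Matrix (Fin 2) (Fin 2) ℝ} {r : ℝ} (hr : 0 ≤ r)
    (h : ∀ i j, |M i j| ≤ r) : ‖M‖ ≤ 2 * r := by
  lift r to ℝ≥0 using hr
  rw [Matrix.linfty_opNorm_def]
  have h1 : (Finset.univ.sup fun i => ∑ j, ‖M i j‖₊) ≤ 2 * r := by
    refine Finset.sup_le fun i _ => ?_
    rw [Fin.sum_univ_two, two_mul]
    exact add_le_add (h i 0) (h i 1)
  exact_mod_cast h1

theorem cosh_dist_I_smul (g : SL(2, ℝ)) :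
    Real.cosh (dist UpperHalfPlane.I (g • UpperHalfPlane.I)) =
      (g 0 0 ^ 2 + g 0 1 ^ 2 + g 1 0 ^ 2 + g 1 1 ^ 2) / 2 := by
  have hdet : g 0 0 * g 1 1 - g 0 1 * g 1 0 = 1 := by
    rw [← Matrix.det_fin_two]
    exact g.det_coe
  have hn : 0 < g 1 0 ^ 2 + g 1 1 ^ 2 := by
    by_contra! h
    have h0 : g 1 0 = 0 := by nlinarith [sq_nonneg (g 1 0), sq_nonneg (g 1 1)]
    have h1 : g 1 1 = 0 := by nlinarith [sq_nonneg (g 1 0), sq_nonneg (g 1 1)]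
    simp [h0, h1] at hdet
  have hcoe := UpperHalfPlane.coe_specialLinearGroup_apply g UpperHalfPlane.I
  have him : (g • UpperHalfPlane.I).im = 1 / (g 1 0 ^ 2 + g 1 1 ^ 2) := by
    have := congrArg Complex.im hcoe
    simp only [UpperHalfPlane.coe_im] at this
    rw [this]
    simp [Complex.div_im, Complex.normSq_apply]
    field_simp
    rw [add_comm (g 1 1 ^ 2), mul_div_cancel_right₀ _ hn.ne']
    linarith
  have hre : (g • UpperHalfPlane.I).re =
      (g 0 0 * g 1 0 + g 0 1 * g 1 1) / (g 1 0 ^ 2 + g 1 1 ^ 2) := by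
    have := congrArg Complex.re hcoe
    simp only [UpperHalfPlane.coe_re] at this
    rw [this]
    simp [Complex.div_re, Complex.normSq_apply]
    field_simp
    rw [add_comm (g 1 1 ^ 2), mul_div_cancel_right₀ _ hn.ne']
    ring
  rw [UpperHalfPlane.cosh_dist', him, hre]
  simp only [UpperHalfPlane.I_re, UpperHalfPlane.I_im]
  field_simp
  linear_combination (-(g 0 0 * g 1 1 - g 0 1 * g 1 0) - 1) * hdet

theorem dist_I_smul_le (g : SL(2, ℝ)) :
    dist UpperHalfPlane.I (g • UpperHalfPlane.I) ≤ 3 * ‖(g : Matrix (Fin 2) (Fin 2) ℝ) - 1‖ := by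
  set d := dist UpperHalfPlane.I (g • UpperHalfPlane.I) with hd
  set ν := ‖(g : Matrix (Fin 2) (Fin 2) ℝ) - 1‖ with hν
  have hd0 : 0 ≤ d := dist_nonneg
  have hdet : g 0 0 * g 1 1 - g 0 1 * g 1 0 = 1 := by
    rw [← Matrix.det_fin_two]
    exact g.det_coe
  have h00 : |g 0 0 - 1| ≤ ν := by simpa using abs_apply_le_norm (g - 1) 0 0
  have h01 : |g 0 1| ≤ ν := by simpa using abs_apply_le_norm (g - 1) 0 1
  have h10 : |g 1 0| ≤ ν := by simpa using abs_apply_le_norm (g - 1) 1 0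
  have h11 : |g 1 1 - 1| ≤ ν := by simpa using abs_apply_le_norm (g - 1) 1 1
  have h1 : |g 0 0 - g 1 1| ≤ 2 * ν := by
    rw [abs_le] at *
    constructor <;> linarith
  have h2 : |g 0 1 + g 1 0| ≤ 2 * ν := by
    rw [abs_le] at *
    constructor <;> linarith
  have h3 : d / 2 ≤ Real.sinh (d / 2) := Real.self_le_sinh_iff.mpr (by positivity)
  have h4 : Real.cosh d = 1 + 2 * Real.sinh (d / 2) ^ 2 := by
    have := Real.cosh_two_mul (d / 2)
    rw [mul_div_cancel₀ d two_ne_zero, Real.cosh_sq] at this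
    linarith
  rw [cosh_dist_I_smul] at h4
  have h5 : (d / 2) ^ 2 ≤ Real.sinh (d / 2) ^ 2 := by gcongr
  have h6 := sq_le_sq' (abs_le.mp h1).1 (abs_le.mp h1).2
  have h7 := sq_le_sq' (abs_le.mp h2).1 (abs_le.mp h2).2
  have hν0 : 0 ≤ ν := norm_nonneg _
  refine abs_le_of_sq_le_sq' ?_ (by positivity) |>.2
  nlinarith

/-! ### Elements close to the identity -/

theorem norm_inv_sl_le {g : SL(2, ℝ)} {r : ℝ} (hr : 0 ≤ r) (h : ∀ i j, |g i j| ≤ r) :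
    ‖((g⁻¹ : SL(2, ℝ)) : Matrix (Fin 2) (Fin 2) ℝ)‖ ≤ 2 * r := by
  refine norm_le_two_mul hr fun i j => ?_
  rw [Matrix.SpecialLinearGroup.SL2_inv_expl]
  fin_cases i <;> fin_cases j <;> simp [h]

theorem norm_inv_mul_sub_one_le (g h : SL(2, ℝ)) :
    ‖((g⁻¹ * h : SL(2, ℝ)) : Matrix (Fin 2) (Fin 2) ℝ) - 1‖ ≤
      ‖((g⁻¹ : SL(2, ℝ)) : Matrix (Fin 2) (Fin 2) ℝ)‖ *
        ‖(h : Matrix (Fin 2) (Fin 2) ℝ) - g‖ := by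
  have h1 : ((g⁻¹ * h : SL(2, ℝ)) : Matrix (Fin 2) (Fin 2) ℝ) - 1 =
      ((g⁻¹ : SL(2, ℝ)) : Matrix (Fin 2) (Fin 2) ℝ) * ((h : Matrix (Fin 2) (Fin 2) ℝ) - g) := by
    rw [mul_sub, ← Matrix.SpecialLinearGroup.coe_mul, ← Matrix.SpecialLinearGroup.coe_mul,
      inv_mul_cancel, Matrix.SpecialLinearGroup.coe_one]
  rw [h1]
  exact norm_mul_le _ _

theorem abs_apply_le_of_near_one {g : SL(2, ℝ)} {r : ℝ}
    (hg : ‖(g : Matrix (Fin 2) (Fin 2) ℝ) - 1‖ ≤ r) (i j : Fin 2) : |g i j| ≤ 1 + r := by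
  have h1 := (abs_apply_le_norm ((g : Matrix (Fin 2) (Fin 2) ℝ) - 1) i j).trans hg
  have h2 : |(1 : Matrix (Fin 2) (Fin 2) ℝ) i j| ≤ 1 := by
    fin_cases i <;> fin_cases j <;> simp
  have h3 := abs_add_le (((g : Matrix (Fin 2) (Fin 2) ℝ) - 1) i j)
    ((1 : Matrix (Fin 2) (Fin 2) ℝ) i j)
  rw [← Matrix.add_apply, sub_add_cancel] at h3
  linarith

theorem norm_inv_le_of_near_one {g : SL(2, ℝ)}
    (hg : ‖(g : Matrix (Fin 2) (Fin 2) ℝ) - 1‖ ≤ 1 / 100) :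
    ‖((g⁻¹ : SL(2, ℝ)) : Matrix (Fin 2) (Fin 2) ℝ)‖ ≤ 3 :=
  (norm_inv_sl_le (by norm_num) (abs_apply_le_of_near_one hg)).trans (by norm_num)

/-- Commutators contract: this is what makes elements of a discrete group that lie close to the
identity commute. -/
theorem norm_commutator_sub_one_le (g h : SL(2, ℝ))
    (hg : ‖(g : Matrix (Fin 2) (Fin 2) ℝ) - 1‖ ≤ 1 / 100)
    (hh : ‖(h : Matrix (Fin 2) (Fin 2) ℝ) - 1‖ ≤ 1 / 100) :
    ‖((g * h * g⁻¹ * h⁻¹ : SL(2, ℝ)) : Matrix (Fin 2) (Fin 2) ℝ) - 1‖ ≤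
      1 / 5 * ‖(g : Matrix (Fin 2) (Fin 2) ℝ) - 1‖ := by
  set X := (g : Matrix (Fin 2) (Fin 2) ℝ) - 1 with hX
  set Y := (h : Matrix (Fin 2) (Fin 2) ℝ) - 1 with hY
  have h1 : ((g * h * g⁻¹ * h⁻¹ : SL(2, ℝ)) : Matrix (Fin 2) (Fin 2) ℝ) - 1 =
      (X * Y - Y * X) * ((g⁻¹ : SL(2, ℝ)) : Matrix (Fin 2) (Fin 2) ℝ) *
        ((h⁻¹ : SL(2, ℝ)) : Matrix (Fin 2) (Fin 2) ℝ) := by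
    have h2 : X * Y - Y * X = ((g * h : SL(2, ℝ)) : Matrix (Fin 2) (Fin 2) ℝ) -
        ((h * g : SL(2, ℝ)) : Matrix (Fin 2) (Fin 2) ℝ) := by
      rw [hX, hY, Matrix.SpecialLinearGroup.coe_mul, Matrix.SpecialLinearGroup.coe_mul]
      noncomm_ring
    rw [h2, sub_mul, sub_mul, ← Matrix.SpecialLinearGroup.coe_mul,
      ← Matrix.SpecialLinearGroup.coe_mul, ← Matrix.SpecialLinearGroup.coe_mul,
      ← Matrix.SpecialLinearGroup.coe_mul]
    congr 1
    rw [mul_inv_cancel_right, mul_inv_cancel, Matrix.SpecialLinearGroup.coe_one]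
  rw [h1]
  have h3 : ‖X * Y - Y * X‖ ≤ 2 * (‖X‖ * ‖Y‖) := by
    have := norm_sub_le (X * Y) (Y * X)
    have := norm_mul_le X Y
    have := norm_mul_le Y X
    linarith [mul_comm ‖X‖ ‖Y‖]
  calc _ ≤ ‖X * Y - Y * X‖ * ‖((g⁻¹ : SL(2, ℝ)) : Matrix (Fin 2) (Fin 2) ℝ)‖ *
        ‖((h⁻¹ : SL(2, ℝ)) : Matrix (Fin 2) (Fin 2) ℝ)‖ := norm_mul₃_le
    _ ≤ 2 * (‖X‖ * (1 / 100)) * 3 * 3 := by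
        gcongr
        · exact h3.trans (by gcongr)
        · exact norm_inv_le_of_near_one hg
        · exact norm_inv_le_of_near_one hh
    _ ≤ 1 / 5 * ‖X‖ := by linarith [norm_nonneg X]

/-- The traceless parts of the matrices commuting with a non-scalar matrix lie on a line, so that
differences of them are controlled by a single coordinate. -/
theorem exists_coordinate {A : Matrix (Fin 2) (Fin 2) ℝ}
    (hA : ¬ (A 0 0 = A 1 1 ∧ A 0 1 = 0 ∧ A 1 0 = 0)) :
    ∃ φ : Matrix (Fin 2) (Fin 2) ℝ → ℝ, (∀ B, |φ B| ≤ 2 * ‖B - 1‖) ∧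
      ∀ B B', A * B = B * A → A * B' = B' * A →
        |(B 0 0 - B 1 1) - (B' 0 0 - B' 1 1)| ≤ |φ B - φ B'| ∧
        |B 0 1 - B' 0 1| ≤ |φ B - φ B'| ∧ |B 1 0 - B' 1 0| ≤ |φ B - φ B'| := by
  have key : ∀ B, A * B = B * A → A 0 1 * B 1 0 = B 0 1 * A 1 0 ∧
      B 0 1 * (A 0 0 - A 1 1) = A 0 1 * (B 0 0 - B 1 1) ∧
      B 1 0 * (A 0 0 - A 1 1) = A 1 0 * (B 0 0 - B 1 1) := by
    intro B h
    have h00 := congrFun (congrFun h 0) 0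
    have h01 := congrFun (congrFun h 0) 1
    have h10 := congrFun (congrFun h 1) 0
    simp only [Matrix.mul_apply, Fin.sum_univ_two] at h00 h01 h10
    refine ⟨?_, ?_, ?_⟩ <;> linarith
  have hle : ∀ {a x y m : ℝ}, 0 < |m| → |a| ≤ |m| → y * m = a * x → |y| ≤ |x| := by
    intro a x y m hm ha h
    have h1 : |y| * |m| = |a| * |x| := by rw [← abs_mul, ← abs_mul, h]
    refine le_of_mul_le_mul_right ?_ hm
    rw [h1, mul_comm |x|]
    gcongr
  set x := A 0 0 - A 1 1 with hx
  set y := A 0 1 with hy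
  set w := A 1 0 with hw
  have hent : ∀ B : Matrix (Fin 2) (Fin 2) ℝ, |B 0 0 - B 1 1| ≤ 2 * ‖B - 1‖ ∧
      |B 0 1| ≤ 2 * ‖B - 1‖ ∧ |B 1 0| ≤ 2 * ‖B - 1‖ := by
    intro B
    have h00 : |B 0 0 - 1| ≤ ‖B - 1‖ := by simpa using abs_apply_le_norm (B - 1) 0 0
    have h01 : |B 0 1| ≤ ‖B - 1‖ := by simpa using abs_apply_le_norm (B - 1) 0 1
    have h10 : |B 1 0| ≤ ‖B - 1‖ := by simpa using abs_apply_le_norm (B - 1) 1 0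
    have h11 : |B 1 1 - 1| ≤ ‖B - 1‖ := by simpa using abs_apply_le_norm (B - 1) 1 1
    have := norm_nonneg (B - 1)
    refine ⟨?_, by linarith, by linarith⟩
    rw [abs_le] at *
    constructor <;> linarith
  have hpos : ∀ {m : ℝ}, |x| ≤ |m| → |y| ≤ |m| → |w| ≤ |m| → 0 < |m| := by
    intro m h1 h2 h3
    by_contra! h
    have h1 := abs_nonpos_iff.mp (h1.trans h)
    have h2 := abs_nonpos_iff.mp (h2.trans h)
    have h3 := abs_nonpos_iff.mp (h3.trans h)
    exact hA ⟨sub_eq_zero.mp h1, h2, h3⟩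
  -- take the coordinate in which the traceless part of `A` is largest
  have hcases : (|y| ≤ |x| ∧ |w| ≤ |x|) ∨ (|x| ≤ |y| ∧ |w| ≤ |y|) ∨ (|x| ≤ |w| ∧ |y| ≤ |w|) := by
    grind
  rcases hcases with ⟨h1, h2⟩ | ⟨h1, h2⟩ | ⟨h1, h2⟩
  · have hm := hpos le_rfl h1 h2
    refine ⟨fun B => B 0 0 - B 1 1, fun B => (hent B).1, fun B B' hB hB' => ?_⟩
    obtain ⟨-, b2, b3⟩ := key B hB
    obtain ⟨-, c2, c3⟩ := key B' hB'
    exact ⟨le_rfl, hle hm h1 (by linarith), hle hm h2 (by linarith)⟩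
  · have hm := hpos h1 le_rfl h2
    refine ⟨fun B => B 0 1, fun B => (hent B).2.1, fun B B' hB hB' => ?_⟩
    obtain ⟨b1, b2, b3⟩ := key B hB
    obtain ⟨c1, c2, c3⟩ := key B' hB'
    exact ⟨hle hm h1 (by linarith), le_rfl, hle hm h2 (by linarith)⟩
  · have hm := hpos h1 h2 le_rfl
    refine ⟨fun B => B 1 0, fun B => (hent B).2.2, fun B B' hB hB' => ?_⟩
    obtain ⟨b1, b2, b3⟩ := key B hB
    obtain ⟨c1, c2, c3⟩ := key B' hB'
    exact ⟨hle hm h1 (by linarith), hle hm h2 (by linarith), le_rfl⟩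

/-- For unimodular matrices near the identity the traceless part determines the trace, in a
Lipschitz way. -/
theorem norm_sub_le_of_traceless {g h : SL(2, ℝ)} {D : ℝ}
    (hg : ‖(g : Matrix (Fin 2) (Fin 2) ℝ) - 1‖ ≤ 1 / 100)
    (hh : ‖(h : Matrix (Fin 2) (Fin 2) ℝ) - 1‖ ≤ 1 / 100)
    (h1 : |(g 0 0 - g 1 1) - (h 0 0 - h 1 1)| ≤ D) (h2 : |g 0 1 - h 0 1| ≤ D)
    (h3 : |g 1 0 - h 1 0| ≤ D) :
    ‖(g : Matrix (Fin 2) (Fin 2) ℝ) - h‖ ≤ 2 * D := by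
  have hD : 0 ≤ D := (abs_nonneg _).trans h2
  have detg : g 0 0 * g 1 1 - g 0 1 * g 1 0 = 1 := by
    rw [← Matrix.det_fin_two]
    exact g.det_coe
  have deth : h 0 0 * h 1 1 - h 0 1 * h 1 0 = 1 := by
    rw [← Matrix.det_fin_two]
    exact h.det_coe
  have g00 : |g 0 0 - 1| ≤ 1 / 100 := by simpa using (abs_apply_le_norm (g - 1) 0 0).trans hg
  have g01 : |g 0 1| ≤ 1 / 100 := by simpa using (abs_apply_le_norm (g - 1) 0 1).trans hg
  have g11 : |g 1 1 - 1| ≤ 1 / 100 := by simpa using (abs_apply_le_norm (g - 1) 1 1).trans hg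
  have h00 : |h 0 0 - 1| ≤ 1 / 100 := by simpa using (abs_apply_le_norm (h - 1) 0 0).trans hh
  have h10 : |h 1 0| ≤ 1 / 100 := by simpa using (abs_apply_le_norm (h - 1) 1 0).trans hh
  have h11 : |h 1 1 - 1| ≤ 1 / 100 := by simpa using (abs_apply_le_norm (h - 1) 1 1).trans hh
  -- the difference of traces, from `(tr g)² = (g₀₀ - g₁₁)² + 4 g₀₁ g₁₀ + 4`
  have htr : |(g 0 0 + g 1 1) - (h 0 0 + h 1 1)| ≤ D := by
    set τ := (g 0 0 + g 1 1) + (h 0 0 + h 1 1) with hτ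
    have hτ3 : 3 ≤ τ := by
      rw [abs_le] at g00 g11 h00 h11
      linarith
    have hid : ((g 0 0 + g 1 1) - (h 0 0 + h 1 1)) * τ =
        ((g 0 0 - g 1 1) - (h 0 0 - h 1 1)) * ((g 0 0 - g 1 1) + (h 0 0 - h 1 1)) +
          4 * g 0 1 * (g 1 0 - h 1 0) + 4 * h 1 0 * (g 0 1 - h 0 1) := by
      linear_combination 4 * detg - 4 * deth
    have hs : |(g 0 0 - g 1 1) + (h 0 0 - h 1 1)| ≤ 1 / 25 := by
      rw [abs_le] at *
      constructor <;> linarith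
    have hmul : |(g 0 0 + g 1 1) - (h 0 0 + h 1 1)| * τ ≤ D * τ := by
      calc |(g 0 0 + g 1 1) - (h 0 0 + h 1 1)| * τ
          = |((g 0 0 + g 1 1) - (h 0 0 + h 1 1)) * τ| := by
            rw [abs_mul, abs_of_pos (by linarith : 0 < τ)]
        _ ≤ |((g 0 0 - g 1 1) - (h 0 0 - h 1 1)) * ((g 0 0 - g 1 1) + (h 0 0 - h 1 1))| +
            |4 * g 0 1 * (g 1 0 - h 1 0)| + |4 * h 1 0 * (g 0 1 - h 0 1)| := by
            rw [hid]
            exact abs_add_three _ _ _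
        _ ≤ D * (1 / 25) + 4 * (1 / 100) * D + 4 * (1 / 100) * D := by
            simp only [abs_mul, abs_of_pos (four_pos : (0 : ℝ) < 4)]
            gcongr
        _ ≤ D * τ := by nlinarith
    exact le_of_mul_le_mul_right hmul (by linarith)
  refine norm_le_two_mul hD fun i j => ?_
  rw [Matrix.sub_apply]
  rw [abs_le] at h1 htr
  fin_cases i <;> fin_cases j
  · exact abs_le.mpr ⟨by simp only [Fin.zero_eta]; linarith, by simp only [Fin.zero_eta]; linarith⟩
  · exact h2
  · exact h3
  · exact abs_le.mpr ⟨by simp only [Fin.mk_one]; linarith, by simp only [Fin.mk_one]; linarith⟩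

theorem card_le_of_separated {α : Type*} (T : Finset α) (φ : α → ℝ) {R η : ℝ} (hη : 0 < η)
    (hR : 0 ≤ R) (hφ : ∀ a ∈ T, |φ a| ≤ R)
    (hsep : ∀ a ∈ T, ∀ b ∈ T, a ≠ b → η ≤ |φ a - φ b|) : (T.card : ℝ) ≤ 2 * (R / η) + 2 := by
  have hinj : Set.InjOn (fun a => ⌊φ a / η⌋) T := by
    intro a ha b hb hab
    by_contra hne
    have h1 := Int.abs_sub_lt_one_of_floor_eq_floor hab
    rw [← sub_div, abs_div, abs_of_pos hη, div_lt_one hη] at h1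
    exact (hsep a ha b hb hne).not_gt h1
  have hmaps : ∀ a ∈ T, ⌊φ a / η⌋ ∈ Finset.Icc ⌊-(R / η)⌋ ⌊R / η⌋ := by
    intro a ha
    have h := abs_le.mp (hφ a ha)
    rw [Finset.mem_Icc, ← neg_div]
    exact ⟨Int.floor_le_floor (by gcongr; exact h.1), Int.floor_le_floor (by gcongr; exact h.2)⟩
  have hcard := Finset.card_le_card_of_injOn _ hmaps hinj
  rw [Int.card_Icc] at hcard
  have h0 : 0 ≤ R / η := by positivity
  have h1 : (T.card : ℤ) ≤ ⌊R / η⌋ + 1 - ⌊-(R / η)⌋ := by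
    have : ⌊-(R / η)⌋ ≤ ⌊R / η⌋ := Int.floor_le_floor (by linarith)
    omega
  have h2 : (T.card : ℝ) ≤ ⌊R / η⌋ + 1 - ⌊-(R / η)⌋ := by exact_mod_cast h1
  have h3 := Int.floor_le (R / η)
  have h4 := Int.lt_floor_add_one (-(R / η))
  linarith

theorem ne_neg_one_of_near_one {g h : SL(2, ℝ)}
    (hg : ‖(g : Matrix (Fin 2) (Fin 2) ℝ) - 1‖ ≤ 1 / 100)
    (hh : ‖(h : Matrix (Fin 2) (Fin 2) ℝ) - 1‖ ≤ 1 / 100) : g⁻¹ * h ≠ -1 := by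
  intro h1
  have h2 : h = -g := by
    rw [inv_mul_eq_iff_eq_mul] at h1
    rw [h1, mul_neg, mul_one]
  have h3 : |g 0 0 - 1| ≤ 1 / 100 := by simpa using (abs_apply_le_norm (g - 1) 0 0).trans hg
  have h4 : |h 0 0 - 1| ≤ 1 / 100 := by simpa using (abs_apply_le_norm (h - 1) 0 0).trans hh
  have h5 : h 0 0 = -g 0 0 := by rw [h2]; rfl
  rw [h5] at h4
  rw [abs_le] at h3 h4
  linarith

/-- Distinct elements near the identity are separated by the least displacement. -/
theorem le_norm_sub_of_near_one {H : Subgroup SL(2, ℝ)} {s : ℝ}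
    (hH : ∀ g ∈ H, g ≠ 1 → g ≠ -1 → s ≤ dist UpperHalfPlane.I (g • UpperHalfPlane.I))
    {g h : SL(2, ℝ)} (hgH : g ∈ H) (hhH : h ∈ H) (hne : g ≠ h)
    (hg : ‖(g : Matrix (Fin 2) (Fin 2) ℝ) - 1‖ ≤ 1 / 100)
    (hh : ‖(h : Matrix (Fin 2) (Fin 2) ℝ) - 1‖ ≤ 1 / 100) :
    s ≤ 9 * ‖(g : Matrix (Fin 2) (Fin 2) ℝ) - h‖ := by
  have h1 := hH (g⁻¹ * h) (H.mul_mem (H.inv_mem hgH) hhH)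
    (fun h => hne (inv_mul_eq_one.mp h)) (ne_neg_one_of_near_one hg hh)
  calc s ≤ _ := h1
    _ ≤ 3 * _ := dist_I_smul_le _
    _ ≤ 3 * (3 * ‖(h : Matrix (Fin 2) (Fin 2) ℝ) - g‖) := by
        gcongr
        refine (norm_inv_mul_sub_one_le g h).trans ?_
        gcongr
        exact norm_inv_le_of_near_one hg
    _ = _ := by rw [norm_sub_rev]; ring

/-- A group all of whose nontrivial elements move `i` by at least `s` has `O(1 / s)` elements near
the identity: they commute with a nontrivial element of nearly minimal size, hence lie on a curve,
along which they are separated by a multiple of `s`. -/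
theorem card_near_one_le {H : Subgroup SL(2, ℝ)} {s : ℝ} (hs : 0 < s)
    (hH : ∀ g ∈ H, g ≠ 1 → g ≠ -1 → s ≤ dist UpperHalfPlane.I (g • UpperHalfPlane.I))
    (T : Finset SL(2, ℝ)) (hTH : ∀ g ∈ T, g ∈ H)
    (hT : ∀ g ∈ T, ‖(g : Matrix (Fin 2) (Fin 2) ℝ) - 1‖ ≤ 1 / 100) :
    (T.card : ℝ) ≤ 2 + 1 / s := by
  have hone : ‖((1 : SL(2, ℝ)) : Matrix (Fin 2) (Fin 2) ℝ) - 1‖ ≤ 1 / 100 := by simp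
  let P : Set SL(2, ℝ) :=
    {g | g ∈ H ∧ g ≠ 1 ∧ ‖(g : Matrix (Fin 2) (Fin 2) ℝ) - 1‖ ≤ 1 / 100}
  by_cases hP : P.Nonempty
  · let ν : SL(2, ℝ) → ℝ := fun g => ‖(g : Matrix (Fin 2) (Fin 2) ℝ) - 1‖
    have hlow : ∀ x ∈ ν '' P, s / 9 ≤ x := by
      rintro _ ⟨g, ⟨hgH, hg1, hg⟩, rfl⟩
      have := le_norm_sub_of_near_one hH hgH H.one_mem hg1 hg hone
      rw [Matrix.SpecialLinearGroup.coe_one] at this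
      change s / 9 ≤ ‖(g : Matrix (Fin 2) (Fin 2) ℝ) - 1‖
      linarith
    have hbdd : BddBelow (ν '' P) := ⟨s / 9, hlow⟩
    have hm : 0 < sInf (ν '' P) :=
      lt_of_lt_of_le (by positivity) (le_csInf (hP.image ν) hlow)
    obtain ⟨_, ⟨A, hAP, rfl⟩, hA2⟩ :=
      exists_lt_of_csInf_lt (hP.image ν) (by linarith : sInf (ν '' P) < 2 * sInf (ν '' P))
    obtain ⟨hAH, hA1, hA⟩ := hAP
    have hcomm : ∀ g ∈ T, A * g = g * A := by
      intro g hg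
      have h1 := norm_commutator_sub_one_le A g hA (hT g hg)
      by_contra hne
      have hP' : A * g * A⁻¹ * g⁻¹ ∈ P := by
        refine ⟨H.mul_mem (H.mul_mem (H.mul_mem hAH (hTH g hg)) (H.inv_mem hAH))
          (H.inv_mem (hTH g hg)), fun h => hne ?_, h1.trans (by linarith)⟩
        rw [mul_inv_eq_one, mul_inv_eq_iff_eq_mul] at h
        exact h
      have h2 : sInf (ν '' P) ≤ ν (A * g * A⁻¹ * g⁻¹) := csInf_le hbdd ⟨_, hP', rfl⟩
      have h3 : ν (A * g * A⁻¹ * g⁻¹) ≤ 1 / 5 * ν A := h1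
      linarith
    have hcomm' : ∀ g ∈ T, (A : Matrix (Fin 2) (Fin 2) ℝ) * g = g * A := fun g hg => by
      rw [← Matrix.SpecialLinearGroup.coe_mul, hcomm g hg, Matrix.SpecialLinearGroup.coe_mul]
    have hns : ¬ ((A : Matrix (Fin 2) (Fin 2) ℝ) 0 0 = (A : Matrix (Fin 2) (Fin 2) ℝ) 1 1 ∧
        (A : Matrix (Fin 2) (Fin 2) ℝ) 0 1 = 0 ∧ (A : Matrix (Fin 2) (Fin 2) ℝ) 1 0 = 0) := by
      rintro ⟨e1, e2, e3⟩
      have detA : A 0 0 * A 1 1 - A 0 1 * A 1 0 = 1 := by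
        rw [← Matrix.det_fin_two]
        exact A.det_coe
      have h00 : |A 0 0 - 1| ≤ 1 / 100 := by
        simpa using (abs_apply_le_norm ((A : Matrix (Fin 2) (Fin 2) ℝ) - 1) 0 0).trans hA
      rw [← e1, e2, zero_mul, sub_zero] at detA
      have h1 : (A : Matrix (Fin 2) (Fin 2) ℝ) 0 0 = 1 := by
        rw [abs_le] at h00
        nlinarith
      refine hA1 (Matrix.SpecialLinearGroup.ext _ _ fun i j => ?_)
      fin_cases i <;> fin_cases j
      · simpa using h1
      · simpa using e2
      · simpa using e3
      · simpa using e1.symm.trans h1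
    obtain ⟨φ, hφ1, hφ2⟩ := exists_coordinate hns
    refine (card_le_of_separated T (fun g => φ g) (R := 1 / 50) (η := s / 18) (by positivity)
      (by norm_num) (fun g hg => (hφ1 g).trans (by linarith [hT g hg]))
      fun g hg h hh hne => ?_).trans ?_
    · obtain ⟨d1, d2, d3⟩ := hφ2 g h (hcomm' g hg) (hcomm' h hh)
      have h1 := norm_sub_le_of_traceless (hT g hg) (hT h hh) d1 d2 d3
      have h2 := le_norm_sub_of_near_one hH (hTH g hg) (hTH h hh) hne (hT g hg) (hT h hh)
      linarith
    · have : 0 < 1 / s := by positivity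
      have h1 : (1 / 50 : ℝ) / (s / 18) = 18 / 50 * (1 / s) := by field_simp
      rw [h1]
      linarith
  · have hsub : T ⊆ {1} := by
      intro g hg
      rw [Finset.mem_singleton]
      by_contra hne
      exact hP ⟨g, hTH g hg, hne, hT g hg⟩
    have h1 : (T.card : ℝ) ≤ 1 := by exact_mod_cast Finset.card_le_card hsub
    have : 0 < 1 / s := by positivity
    linarith

theorem abs_apply_le_three {g : SL(2, ℝ)}
    (hg : dist UpperHalfPlane.I (g • UpperHalfPlane.I) ≤ 2) (i j : Fin 2) : |g i j| ≤ 3 := by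
  have h1 : Real.cosh (dist UpperHalfPlane.I (g • UpperHalfPlane.I)) ≤ Real.cosh 2 := by
    rw [Real.cosh_le_cosh, abs_of_nonneg dist_nonneg]
    simpa using hg
  rw [cosh_dist_I_smul] at h1
  have h2 : Real.cosh 2 ≤ 9 / 2 := by
    have e1 : Real.exp 2 = Real.exp 1 ^ 2 := by rw [← Real.exp_nat_mul]; norm_num
    have e2 := Real.exp_one_lt_d9
    have e3 : Real.exp (-2) ≤ 1 := Real.exp_le_one_iff.mpr (by norm_num)
    have e4 := Real.exp_pos 1
    rw [Real.cosh_eq, e1]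
    nlinarith
  refine abs_le_of_sq_le_sq ?_ (by norm_num)
  fin_cases i <;> fin_cases j <;> simp only [Fin.zero_eta, Fin.mk_one] <;>
    nlinarith [sq_nonneg (g 0 0), sq_nonneg (g 0 1), sq_nonneg (g 1 0), sq_nonneg (g 1 1)]

/-- The elements that move `i` by at most two lie in finitely many translates of a neighbourhood of
the identity, whose number does not depend on the group. -/
theorem exists_card_le_div_sl : ∃ C : ℝ, 0 < C ∧ ∀ (H : Subgroup SL(2, ℝ)) (s : ℝ), 0 < s → s ≤ 1 →
    (∀ g ∈ H, g ≠ 1 → g ≠ -1 → s ≤ dist UpperHalfPlane.I (g • UpperHalfPlane.I)) →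
    ∀ T : Finset SL(2, ℝ), (∀ g ∈ T, g ∈ H) →
      (∀ g ∈ T, dist UpperHalfPlane.I (g • UpperHalfPlane.I) ≤ 2) → (T.card : ℝ) ≤ C / s := by
  classical
  -- the grid of mesh `1 / 1200` in the entries
  obtain ⟨I, hmem⟩ : ∃ I : Finset ℤ, ∀ x : ℝ, |x| ≤ 3 → ⌊1200 * x⌋ ∈ I := by
    refine ⟨Finset.Icc (-3600) 3600, fun x hx => ?_⟩
    rw [abs_le] at hx
    rw [Finset.mem_Icc, Int.le_floor, ← Int.cast_le (R := ℝ)]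
    have := Int.floor_le (1200 * x)
    push_cast
    constructor <;> linarith
  let K : ℕ := (I ×ˢ I ×ˢ I ×ˢ I).card
  have hK : (0 : ℝ) ≤ K := Nat.cast_nonneg K
  refine ⟨3 * K + 1, by positivity, fun H s hs hs1 hH T hTH hT => ?_⟩
  let F : SL(2, ℝ) → ℤ × ℤ × ℤ × ℤ := fun g =>
    (⌊1200 * g 0 0⌋, ⌊1200 * g 0 1⌋, ⌊1200 * g 1 0⌋, ⌊1200 * g 1 1⌋)
  have hmaps : ∀ g ∈ T, F g ∈ I ×ˢ I ×ˢ I ×ˢ I := by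
    intro g hg
    simp only [F, Finset.mem_product]
    exact ⟨hmem _ (abs_apply_le_three (hT g hg) 0 0), hmem _ (abs_apply_le_three (hT g hg) 0 1),
      hmem _ (abs_apply_le_three (hT g hg) 1 0), hmem _ (abs_apply_le_three (hT g hg) 1 1)⟩
  have hfib : ∀ b ∈ I ×ˢ I ×ˢ I ×ˢ I, (T.filter fun g => F g = b).card ≤ ⌊2 + 1 / s⌋₊ := by
    intro b _
    refine Nat.le_floor ?_
    rcases (T.filter fun g => F g = b).eq_empty_or_nonempty with he | ⟨g₀, hg₀⟩
    · rw [he]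
      simp only [Finset.card_empty, Nat.cast_zero]
      positivity
    · rw [← Finset.card_image_of_injective _ (mul_right_injective g₀⁻¹)]
      rw [Finset.mem_filter] at hg₀
      refine card_near_one_le hs hH _ ?_ ?_
      · intro g hg
        obtain ⟨h, hh, rfl⟩ := Finset.mem_image.mp hg
        exact H.mul_mem (H.inv_mem (hTH _ hg₀.1)) (hTH _ (Finset.mem_filter.mp hh).1)
      · intro g hg
        obtain ⟨h, hh, rfl⟩ := Finset.mem_image.mp hg
        have hF : F h = F g₀ := (Finset.mem_filter.mp hh).2.trans hg₀.2.symm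
        simp only [F, Prod.mk.injEq] at hF
        obtain ⟨f00, f01, f10, f11⟩ := hF
        have hclose : ∀ {x y : ℝ}, ⌊1200 * x⌋ = ⌊1200 * y⌋ → |x - y| ≤ 1 / 1200 := by
          intro x y hxy
          have := Int.abs_sub_lt_one_of_floor_eq_floor hxy
          rw [← mul_sub, abs_mul, abs_of_pos (by norm_num)] at this
          linarith
        have hdiff : ‖(h : Matrix (Fin 2) (Fin 2) ℝ) - g₀‖ ≤ 2 * (1 / 1200) := by
          refine norm_le_two_mul (by norm_num) fun i j => ?_
          rw [Matrix.sub_apply]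
          fin_cases i <;> fin_cases j
          exacts [hclose f00, hclose f01, hclose f10, hclose f11]
        calc _ ≤ _ := norm_inv_mul_sub_one_le g₀ h
          _ ≤ (2 * 3) * (2 * (1 / 1200)) := by
              gcongr
              exact norm_inv_sl_le (by norm_num) (abs_apply_le_three (hT _ hg₀.1))
          _ ≤ 1 / 100 := by norm_num
  have hcard := Finset.card_le_mul_card_image_of_maps_to hmaps _ hfib
  have h1 : (T.card : ℝ) ≤ (⌊2 + 1 / s⌋₊ : ℝ) * K := by exact_mod_cast hcard
  have h2 : (⌊2 + 1 / s⌋₊ : ℝ) ≤ 2 + 1 / s := Nat.floor_le (by positivity)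
  have h3 : 1 ≤ 1 / s := (one_le_div hs).mpr hs1
  calc (T.card : ℝ) ≤ (2 + 1 / s) * K := h1.trans (by gcongr)
    _ ≤ (3 * (1 / s)) * K := by gcongr; linarith
    _ ≤ (3 * K + 1) / s := by
        rw [add_div]
        have : 3 * (1 / s) * K = 3 * K / s := by ring
        linarith

end Matrices

/-! ### Counting orbit points -/

theorem mem_center_iff_eq_or_eq_neg (g : SL(2, ℝ)) :
    g ∈ Subgroup.center SL(2, ℝ) ↔ g = 1 ∨ g = -1 := by
  rw [Matrix.SpecialLinearGroup.mem_center_iff]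
  constructor
  · rintro ⟨r, hr, hrg⟩
    rw [Fintype.card_fin, sq_eq_one_iff] at hr
    rcases hr with rfl | rfl
    · left
      ext i j
      rw [← hrg]
      simp
    · right
      ext i j
      rw [← hrg]
      fin_cases i <;> fin_cases j <;> simp
  · rintro (rfl | rfl)
    · exact ⟨1, by simp, by simp⟩
    · refine ⟨-1, by simp, ?_⟩
      ext i j
      fin_cases i <;> fin_cases j <;> simp

/-- A group all of whose nontrivial elements displace `z₀` by at least `s` has `O(1 / s)` elements
that displace `z₀` by at most two. -/
theorem exists_card_le_div : ∃ C : ℝ, 0 < C ∧ ∀ (Γ : Subgroup PSL(2, ℝ)) (z₀ : ℍ) (s : ℝ),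
    0 < s → s ≤ 1 → (∀ A : Γ, A ≠ 1 → s ≤ dist z₀ (A • z₀)) →
    ∀ T : Finset Γ, (∀ A ∈ T, dist z₀ (A • z₀) ≤ 2) → (T.card : ℝ) ≤ C / s := by
  classical
  obtain ⟨C, hC, h⟩ := exists_card_le_div_sl
  refine ⟨C, hC, fun Γ z₀ s hs hs1 hΓ T hT => ?_⟩
  obtain ⟨k, hk⟩ := MulAction.exists_smul_eq SL(2, ℝ) UpperHalfPlane.I z₀
  -- the preimage of `Γ` in `SL(2, ℝ)`, conjugated so that `z₀` becomes `i`
  let H : Subgroup SL(2, ℝ) :=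
    (Γ.comap (QuotientGroup.mk' (Subgroup.center SL(2, ℝ)))).comap (MulAut.conj k).toMonoidHom
  have hdist : ∀ g : SL(2, ℝ), dist UpperHalfPlane.I (g • UpperHalfPlane.I) =
      dist z₀ ((QuotientGroup.mk (k * g * k⁻¹) : PSL(2, ℝ)) • z₀) := by
    intro g
    rw [mk_smul, ← hk, mul_smul, inv_smul_smul, mul_smul, dist_smul]
  have hH : ∀ g ∈ H, g ≠ 1 → g ≠ -1 → s ≤ dist UpperHalfPlane.I (g • UpperHalfPlane.I) := by
    intro g hg h1 h2
    rw [hdist]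
    refine hΓ ⟨_, hg⟩ fun he => ?_
    have he' : (QuotientGroup.mk (k * g * k⁻¹) : PSL(2, ℝ)) = 1 := congrArg Subtype.val he
    rw [QuotientGroup.eq_one_iff] at he'
    have hc : g ∈ Subgroup.center SL(2, ℝ) := by
      have := Subgroup.Normal.conj_mem inferInstance _ he' k⁻¹
      simpa [mul_assoc] using this
    rcases (mem_center_iff_eq_or_eq_neg g).mp hc with h | h
    exacts [h1 h, h2 h]
  let m : Γ → SL(2, ℝ) := fun A => k⁻¹ * (A : PSL(2, ℝ)).out * k
  have hm : ∀ A : Γ, (QuotientGroup.mk (k * m A * k⁻¹) : PSL(2, ℝ)) = A := by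
    intro A
    have : k * m A * k⁻¹ = (A : PSL(2, ℝ)).out := by
      simp only [m]
      group
    rw [this]
    exact Quotient.out_eq _
  have hinj : Function.Injective m := fun A B hAB => Subtype.ext (by rw [← hm A, ← hm B, hAB])
  rw [← Finset.card_image_of_injective T hinj]
  refine h H s hs hs1 hH _ ?_ ?_
  · intro g hg
    obtain ⟨A, -, rfl⟩ := Finset.mem_image.mp hg
    change (QuotientGroup.mk (k * m A * k⁻¹) : PSL(2, ℝ)) ∈ Γ
    rw [hm]
    exact A.2
  · intro g hg
    obtain ⟨A, hA, rfl⟩ := Finset.mem_image.mp hg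
    rw [hdist, hm]
    exact hT A hA

/-- Orbit points in a disc are counted by comparing areas: the unit discs about the orbit points
cover each point `O(1 / s)` times. -/
theorem exists_card_orbit_le : ∃ C : ℝ, 0 < C ∧ ∀ (Γ : Subgroup PSL(2, ℝ)) (z₀ : ℍ) (s : ℝ),
    0 < s → s ≤ 1 → (∀ A : Γ, A ≠ 1 → s ≤ dist z₀ (A • z₀)) →
    ∀ (z : ℍ) (t : ℝ), 0 ≤ t → ∀ T : Finset Γ, (∀ A ∈ T, dist z (A • z₀) ≤ t) →
      (T.card : ℝ) ≤ C / s * Real.exp t := by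
  classical
  obtain ⟨C, hC, hcount⟩ := exists_card_le_div
  set v : ℝ := ((volume : Measure ℍ) (Metric.ball UpperHalfPlane.I 1)).toReal with hv
  have hv0 : 0 < v :=
    ENNReal.toReal_pos (volume_ball_pos _ one_pos).ne' (volume_ball_ne_top _ _)
  refine ⟨C * (8 * Real.exp 1) / v, by positivity, fun Γ z₀ s hs hs1 hΓ z t ht T hT => ?_⟩
  have hpoint : ∀ w : ℍ, ∑ A ∈ T, (Metric.ball (A • z₀) 1).indicator (fun _ => (1 : ℝ≥0∞)) w ≤
      (Metric.ball z (t + 1)).indicator (fun _ => ENNReal.ofReal (C / s)) w := by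
    intro w
    have hsum : ∑ A ∈ T, (Metric.ball (A • z₀) 1).indicator (fun _ => (1 : ℝ≥0∞)) w =
        ((T.filter fun A => w ∈ Metric.ball (A • z₀) 1).card : ℝ≥0∞) := by
      simp [Set.indicator_apply]
    rw [hsum]
    rcases (T.filter fun A => w ∈ Metric.ball (A • z₀) 1).eq_empty_or_nonempty with he | ⟨A₀, hA₀⟩
    · rw [he]
      simp
    · rw [Finset.mem_filter, Metric.mem_ball] at hA₀
      have hw : w ∈ Metric.ball z (t + 1) := by
        rw [Metric.mem_ball]
        have := dist_triangle w (A₀ • z₀) z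
        rw [dist_comm (A₀ • z₀) z] at this
        linarith [hT _ hA₀.1, hA₀.2]
      rw [Set.indicator_of_mem hw, ← Finset.card_image_of_injective _ (mul_right_injective A₀⁻¹),
        ← ENNReal.ofReal_natCast]
      refine ENNReal.ofReal_le_ofReal (hcount Γ z₀ s hs hs1 hΓ _ fun B hB => ?_)
      obtain ⟨A, hA, rfl⟩ := Finset.mem_image.mp hB
      rw [Finset.mem_filter, Metric.mem_ball] at hA
      rw [mul_smul, ← dist_smul A₀, smul_inv_smul]
      have := dist_triangle_left (A₀ • z₀) (A • z₀) w
      linarith [hA.2, hA₀.2]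
  have hvol : (T.card : ℝ≥0∞) * volume (Metric.ball UpperHalfPlane.I 1) ≤
      ENNReal.ofReal (C / s) * ENNReal.ofReal (8 * Real.cosh (t + 1)) := by
    calc (T.card : ℝ≥0∞) * volume (Metric.ball UpperHalfPlane.I 1)
        = ∑ A ∈ T, ∫⁻ w : ℍ, (Metric.ball (A • z₀) 1).indicator (fun _ => (1 : ℝ≥0∞)) w := by
          rw [Finset.sum_congr rfl fun A _ => (lintegral_indicator_const measurableSet_ball 1).trans
            (congrArg _ (volume_ball_eq (A • z₀) UpperHalfPlane.I 1))]
          simp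
      _ = ∫⁻ w : ℍ, ∑ A ∈ T, (Metric.ball (A • z₀) 1).indicator (fun _ => (1 : ℝ≥0∞)) w :=
          (lintegral_finsetSum _ fun A _ => measurable_const.indicator measurableSet_ball).symm
      _ ≤ ∫⁻ w : ℍ, (Metric.ball z (t + 1)).indicator (fun _ => ENNReal.ofReal (C / s)) w :=
          lintegral_mono hpoint
      _ = ENNReal.ofReal (C / s) * volume (Metric.ball z (t + 1)) :=
          lintegral_indicator_const measurableSet_ball _
      _ ≤ _ := by
          gcongr
          exact volume_ball_le z (by positivity)
  have hreal : (T.card : ℝ) * v ≤ C / s * (8 * Real.cosh (t + 1)) := by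
    have h1 := ENNReal.toReal_mono (ENNReal.mul_ne_top ENNReal.ofReal_ne_top
      ENNReal.ofReal_ne_top) hvol
    rwa [ENNReal.toReal_mul, ENNReal.toReal_mul, ENNReal.toReal_natCast,
      ENNReal.toReal_ofReal (by positivity), ENNReal.toReal_ofReal (by positivity)] at h1
  have hcosh : Real.cosh (t + 1) ≤ Real.exp 1 * Real.exp t := by
    rw [← Real.exp_add, add_comm 1 t, ← Real.cosh_add_sinh (t + 1)]
    have := Real.sinh_nonneg_iff.mpr (by positivity : 0 ≤ t + 1)
    linarith
  have h2 : (T.card : ℝ) ≤ C / s * (8 * Real.cosh (t + 1)) / v := (le_div_iff₀ hv0).mpr hreal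
  calc (T.card : ℝ) ≤ C / s * (8 * Real.cosh (t + 1)) / v := h2
    _ ≤ C / s * (8 * (Real.exp 1 * Real.exp t)) / v := by gcongr
    _ = _ := by ring

theorem sum_exp_neg_le (S : Finset ℕ) : ∑ n ∈ S, Real.exp (-(n : ℝ)) ≤ 2 := by
  have h1 : ∀ n : ℕ, Real.exp (-(n : ℝ)) = Real.exp (-1) ^ n := by
    intro n
    rw [← Real.exp_nat_mul]
    congr 1
    ring
  have h2 : Real.exp (-1) ≤ 1 / 2 := by
    rw [Real.exp_neg, one_div]
    have := Real.add_one_le_exp 1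
    exact inv_anti₀ (by norm_num) (by linarith)
  have h0 := Real.exp_pos (-1)
  simp only [h1]
  have h3 : Real.exp (-1) < 1 := by linarith
  refine ((summable_geometric_of_lt_one h0.le h3).sum_le_tsum S fun _ _ => by positivity).trans ?_
  rw [tsum_geometric_of_lt_one h0.le h3]
  exact inv_le_of_inv_le₀ (by norm_num) (by linarith)

/-- The orbital sum of `exp (-2 d)`, estimated over shells of unit width: the shell at distance
`δ + n` holds `O(exp (δ + n) / s)` orbit points. -/
theorem exists_sum_exp_le : ∃ C : ℝ, 0 < C ∧ ∀ (Γ : Subgroup PSL(2, ℝ)) (z₀ : ℍ) (s : ℝ),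
    0 < s → s ≤ 1 → (∀ A : Γ, A ≠ 1 → s ≤ dist z₀ (A • z₀)) →
    ∀ (z : ℍ) (δ : ℝ), 0 ≤ δ → ∀ T : Finset Γ, (∀ A ∈ T, δ ≤ dist z (A • z₀)) →
      ∑ A ∈ T, Real.exp (-(2 * dist z (A • z₀))) ≤ C / s * Real.exp (-δ) := by
  classical
  obtain ⟨C, hC, hcount⟩ := exists_card_orbit_le
  refine ⟨C * Real.exp 1 * 2, by positivity, fun Γ z₀ s hs hs1 hΓ z δ hδ T hT => ?_⟩
  let n : Γ → ℕ := fun A => ⌊dist z (A • z₀) - δ⌋₊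
  have hshell : ∀ k : ℕ, ∑ A ∈ T.filter (fun A => n A = k), Real.exp (-(2 * dist z (A • z₀))) ≤
      C / s * Real.exp 1 * Real.exp (-δ) * Real.exp (-(k : ℝ)) := by
    intro k
    have hlow : ∀ A ∈ T.filter (fun A => n A = k), δ + k ≤ dist z (A • z₀) := by
      intro A hA
      rw [Finset.mem_filter] at hA
      have := Nat.floor_le (sub_nonneg.mpr (hT A hA.1))
      rw [show ⌊dist z (A • z₀) - δ⌋₊ = k from hA.2] at this
      linarith
    have hup : ∀ A ∈ T.filter (fun A => n A = k), dist z (A • z₀) ≤ δ + k + 1 := by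
      intro A hA
      rw [Finset.mem_filter] at hA
      have := Nat.lt_floor_add_one (dist z (A • z₀) - δ)
      rw [show ⌊dist z (A • z₀) - δ⌋₊ = k from hA.2] at this
      linarith
    calc _ ≤ (T.filter fun A => n A = k).card • Real.exp (-(2 * (δ + k))) := by
          refine Finset.sum_le_card_nsmul _ _ _ fun A hA => ?_
          have := hlow A hA
          gcongr
      _ ≤ C / s * Real.exp (δ + k + 1) * Real.exp (-(2 * (δ + k))) := by
          rw [nsmul_eq_mul]
          gcongr
          exact hcount Γ z₀ s hs hs1 hΓ z _ (by positivity) _ hup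
      _ = _ := by
          rw [mul_assoc, mul_assoc, mul_assoc, ← Real.exp_add, ← Real.exp_add, ← Real.exp_add]
          congr 2
          ring
  rw [← Finset.sum_fiberwise_of_maps_to (t := T.image n) fun A hA => Finset.mem_image_of_mem n hA]
  calc _ ≤ ∑ k ∈ T.image n, C / s * Real.exp 1 * Real.exp (-δ) * Real.exp (-(k : ℝ)) :=
        Finset.sum_le_sum fun k _ => hshell k
    _ = C / s * Real.exp 1 * Real.exp (-δ) * ∑ k ∈ T.image n, Real.exp (-(k : ℝ)) :=
        (Finset.mul_sum _ _ _).symm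
    _ ≤ C / s * Real.exp 1 * Real.exp (-δ) * 2 := by
        gcongr
        exact sum_exp_neg_le _
    _ = _ := by ring

/-! ### The Green's function -/

theorem inv_max_mem (x : ℝ) : 0 < (max 1 x)⁻¹ ∧ (max 1 x)⁻¹ ≤ 1 :=
  ⟨by positivity, inv_le_one_of_one_le₀ (le_max_left _ _)⟩

theorem IsUniformizing.summable_Q₂ {Γ : Subgroup PSL(2, ℝ)} (hΓ : IsUniformizing Γ) (z z₀ : ℍ) :
    Summable fun A : Γ => Q₂ z (A • z₀) := by
  classical
  obtain ⟨C, hC, h⟩ := exists_sum_exp_le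
  obtain ⟨hs, hs1⟩ := inv_max_mem (invInj Γ z₀)
  have hexp : Summable fun A : Γ => Real.exp (-(2 * dist z (A • z₀))) :=
    summable_of_sum_le (fun _ => (Real.exp_pos _).le) fun T =>
      h Γ z₀ _ hs hs1 (hΓ.inv_max_le_dist z₀) z 0 le_rfl T fun _ _ => dist_nonneg
  -- the terms at distance less than one are finite in number
  refine (hexp.mul_left 16).of_norm_bounded_eventually ?_
  refine (hΓ.finite_dist_le z z₀ 1).subset fun A hA => ?_
  by_contra hA1
  have hA1 : 1 < dist z (A • z₀) := not_le.mp hA1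
  refine hA ?_
  change ‖Q₂ z (A • z₀)‖ ≤ 16 * Real.exp (-(2 * dist z (A • z₀)))
  rw [← norm_neg, Real.norm_of_nonneg (neg_Q₂_nonneg (dist_pos.mp (one_pos.trans hA1)))]
  exact neg_Q₂_le hA1.le

theorem neg_G₂ (Γ : Subgroup PSL(2, ℝ)) (z z₀ : ℍ) :
    -G₂ Γ z z₀ = ∑' A : Γ, -Q₂ z (A • z₀) := tsum_neg.symm

theorem exists_neg_G₂_le_one_side : ∃ C : ℝ, 0 < C ∧ ∀ Γ : Subgroup PSL(2, ℝ), IsUniformizing Γ →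
    ∀ z z₀ : ℍ, 1 ≤ quotDist Γ z z₀ →
      -G₂ Γ z z₀ ≤ C * max 1 (invInj Γ z₀) * Real.exp (-quotDist Γ z z₀) := by
  obtain ⟨C, hC, h⟩ := exists_sum_exp_le
  refine ⟨16 * C, by positivity, fun Γ hΓ z z₀ hd => ?_⟩
  obtain ⟨hs, hs1⟩ := inv_max_mem (invInj Γ z₀)
  have hd' : ∀ A : Γ, 1 ≤ dist z (A • z₀) := fun A => hd.trans (quotDist_le Γ z z₀ A)
  rw [neg_G₂]
  refine (hΓ.summable_Q₂ z z₀).neg.tsum_le_of_sum_le fun T => ?_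
  calc ∑ A ∈ T, -Q₂ z (A • z₀) ≤ ∑ A ∈ T, 16 * Real.exp (-(2 * dist z (A • z₀))) :=
        Finset.sum_le_sum fun A _ => neg_Q₂_le (hd' A)
    _ = 16 * ∑ A ∈ T, Real.exp (-(2 * dist z (A • z₀))) := (Finset.mul_sum _ _ _).symm
    _ ≤ 16 * (C / (max 1 (invInj Γ z₀))⁻¹ * Real.exp (-quotDist Γ z z₀)) := by
        gcongr
        exact h Γ z₀ _ hs hs1 (hΓ.inv_max_le_dist z₀) z _ (by linarith) T
          fun A _ => quotDist_le Γ z z₀ A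
    _ = _ := by rw [div_inv_eq_mul]; ring

theorem exists_neg_G₂_le : ∃ C : ℝ, 0 < C ∧ ∀ Γ : Subgroup PSL(2, ℝ), IsUniformizing Γ →
    ∀ z z₀ : ℍ, 1 ≤ quotDist Γ z z₀ →
      -G₂ Γ z z₀ ≤ C * max 1 (min (invInj Γ z) (invInj Γ z₀)) * Real.exp (-quotDist Γ z z₀) := by
  obtain ⟨C, hC, h⟩ := exists_neg_G₂_le_one_side
  refine ⟨C, hC, fun Γ hΓ z z₀ hd => ?_⟩
  rcases min_choice (invInj Γ z) (invInj Γ z₀) with hmin | hmin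
  · rw [hmin, G₂_comm, quotDist_comm]
    exact h Γ hΓ z₀ z (by rwa [quotDist_comm])
  · rw [hmin]
    exact h Γ hΓ z z₀ hd

/-- A surface of area at most `a` contains no embedded disc of larger area. -/
theorem exists_le_invInj (a : ℝ) : ∃ b : ℝ, 0 < b ∧ ∀ Γ : Subgroup PSL(2, ℝ), IsUniformizing Γ →
    AreaLE Γ a → ∀ z : ℍ, b ≤ invInj Γ z := by
  obtain ⟨r, hr, hvol⟩ := exists_lt_volume_ball (ENNReal.ofReal a) ENNReal.ofReal_ne_top
  refine ⟨r⁻¹, by positivity, fun Γ hΓ ⟨F, hF, hFa⟩ z => ?_⟩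
  have := hΓ.countable
  have hle : injRad Γ z ≤ ENNReal.ofReal r := by
    refine iSup₂_le fun ρ hρ => ?_
    by_contra! hlt
    rw [← ENNReal.ofReal_coe_nnreal, ENNReal.ofReal_lt_ofReal_iff_of_nonneg hr.le] at hlt
    have hFlt : volume F < volume (Metric.ball z (ρ : ℝ)) :=
      (hFa.trans_lt (hvol z)).trans_le (measure_mono (Metric.ball_subset_ball hlt.le))
    obtain ⟨x, hx, y, hy, A, hA, rfl⟩ :=
      hF.exists_ne_one_smul_eq measurableSet_ball.nullMeasurableSet hFlt
    exact hA (hΓ.free A x (hρ hy hx (Quotient.sound ⟨A, rfl⟩)))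
  have h1 := ENNReal.toReal_mono (ENNReal.inv_ne_top.mpr (hΓ.injRad_ne_zero z))
    (ENNReal.inv_le_inv.mpr hle)
  rwa [ENNReal.toReal_inv, ENNReal.toReal_ofReal hr.le] at h1

end WPGreen

theorem mainTheorem7 :
    -- convergence of the series and the lower bound
    (∀ Γ : Subgroup PSL(2, ℝ), WPGreen.IsUniformizing Γ → ∀ z z₀ : ℍ,
        (∀ A : Γ, A • z₀ ≠ z) →
          Summable (fun A : Γ => WPGreen.Q₂ z (A • z₀)) ∧
            -WPGreen.Q₂ z z₀ ≤ -WPGreen.G₂ Γ z z₀) ∧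
    -- upper bound, constant depending only on the area (the topological type)
    (∀ a : ℝ, ∃ c : ℝ, 0 < c ∧ ∀ Γ : Subgroup PSL(2, ℝ), WPGreen.IsUniformizing Γ →
        WPGreen.AreaLE Γ a → ∀ z z₀ : ℍ, 1 ≤ WPGreen.quotDist Γ z z₀ →
          -WPGreen.G₂ Γ z z₀ ≤
            c * min (WPGreen.invInj Γ z) (WPGreen.invInj Γ z₀) *
              Real.exp (-WPGreen.quotDist Γ z z₀)) ∧
    -- upper bound, absolute constant
    (∃ c : ℝ, 0 < c ∧ ∀ Γ : Subgroup PSL(2, ℝ), WPGreen.IsUniformizing Γ →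
        ∀ z z₀ : ℍ, 1 ≤ WPGreen.quotDist Γ z z₀ →
          -WPGreen.G₂ Γ z z₀ ≤
            c * max 1 (min (WPGreen.invInj Γ z) (WPGreen.invInj Γ z₀)) *
              Real.exp (-WPGreen.quotDist Γ z z₀)) := by
  refine ⟨fun Γ hΓ z z₀ hne => ⟨hΓ.summable_Q₂ z z₀, ?_⟩, fun a => ?_, WPGreen.exists_neg_G₂_le⟩
  · rw [WPGreen.neg_G₂]
    simpa using (hΓ.summable_Q₂ z z₀).neg.le_tsum (1 : Γ)
      fun A _ => WPGreen.neg_Q₂_nonneg (hne A).symm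
  · obtain ⟨C, hC, h⟩ := WPGreen.exists_neg_G₂_le
    obtain ⟨b, hb, hinj⟩ := WPGreen.exists_le_invInj a
    refine ⟨C * max 1 b⁻¹, by positivity, fun Γ hΓ ha z z₀ hd => (h Γ hΓ z z₀ hd).trans ?_⟩
    set μ := min (WPGreen.invInj Γ z) (WPGreen.invInj Γ z₀) with hμ
    have hbμ : b ≤ μ := le_min (hinj Γ hΓ ha z) (hinj Γ hΓ ha z₀)
    have hμ0 : 0 < μ := hb.trans_le hbμ
    have hmax : max 1 μ ≤ max 1 b⁻¹ * μ := by
      refine max_le ?_ (le_mul_of_one_le_left hμ0.le (le_max_left _ _))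
      calc (1 : ℝ) = b⁻¹ * b := (inv_mul_cancel₀ hb.ne').symm
        _ ≤ max 1 b⁻¹ * μ := by
            gcongr
            exact le_max_right _ _
    rw [mul_assoc C (max 1 b⁻¹)]
    exact mul_le_mul_of_nonneg_right (mul_le_mul_of_nonneg_left hmax hC.le) (Real.exp_pos _).le
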